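/- Let $\mathcal H_S$ (the system) be a finite-dimensional complex Hilbert space and $\mathcal H_A$ (the apparatus) an arbitrary complex Hilbert space. Write $\mathcal L(\mathcal H)$ for the bounded operators and $\mathcal T(\mathcal H)$ for the trace-class operators on $\mathcal H$; a state is a positive operator in $\mathcal T(\mathcal H)$ of trace $1$, an operation is a completely positive trace-non-increasing linear map between spaces of trace-class operators, and a channel is a trace-preserving operation. Let $\mathcal X$ be a countable set. An observable on $\mathcal H$ is a family $\{\mathsf E(x)\}_{x\in\mathcal X}$ of positive operators in $\mathcal L(\mathcal H)$ with $\sum_x \mathsf E(x)=\mathbb 1$ (strongly); it is sharp if $\mathsf E(x)\mathsf E(y)=\delta_{x,y}\mathsf E(x)$ for all $x,y$. An $\mathsf E$-instrument is a family of operations $\mathcal I_x:\mathcal T(\mathcal H_S)\to\mathcal T(\mathcal H_S)$, $x\in\mathcal X$, whose sum is a channel, with $\mathrm{tr}[\mathcal I_x(T)]=\mathrm{tr}[\mathsf E(x)T]$ for all $x$ and $T$. It is repeatable if $\mathrm{tr}[\mathcal I_y(\mathcal I_x(\rho))]=\delta_{x,y}\,\mathrm{tr}[\mathcal I_x(\rho)]$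 for all states $\rho$ and all $x,y\in\mathcal X$. A measurement scheme $(\mathcal H_A,\xi,\mathcal E,\mathsf Z)$ consists of a state $\xi$ on $\mathcal H_A$, a channel $\mathcal E:\mathcal T(\mathcal H_S\otimes\mathcal H_A)\to\mathcal T(\mathcal H_S\otimes\mathcal H_A)$ and an observable $\mathsf Z=\{\mathsf Z(x)\}_{x\in\mathcal X}$ on $\mathcal H_A$; it implements $\mathcal I$ if $\mathcal I_x(T)=\mathrm{tr}_A[(\mathbb 1\otimes\mathsf Z(x))\,\mathcal E(T\otimes\xi)]$ for all $x$ and all $T\in\mathcal T(\mathcal H_S)$. **Corollary.** Let $\mathsf E$ be an observable on $\mathcal H_S$ and let $(\mathcal H_A,\xi,\mathcal E,\mathsf Z)$ be a measurement scheme that implements an $\mathsf E$-instrument $\mathcal I$. Let $N_S\in\mathcal L(\mathcal H_S)$ and $N_A\in\mathcal L(\mathcal H_A)$ be self-adjoint, and assume that $\mathcal E$ conserves the additive quantity $N=N_S\otimes\mathbb 1+\mathbb 1\otimes N_A$ on average, i.e. $\mathrm{tr}[N\mathcal E(\rho)]=\mathrm{tr}[N\rho]$ for all states $\rho$ on $\mathcal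 H_S\otimes\mathcal H_A$. For $x\in\mathcal X$ let $\mathsf P(x)$ be the orthogonal projection onto the eigenvalue-$1$ eigenspace $\{\psi:\mathsf E(x)\psi=\psi\}$. If $\mathcal I$ is repeatable, then the sum $\mathsf P(\mathcal X):=\sum_{x\in\mathcal X}\mathsf P(x)$ converges and $$[\mathsf E(x),\ \mathsf P(\mathcal X)\,N_S\,\mathsf P(\mathcal X)]=0\qquad\text{for all } x\in\mathcal X .$$ If, in addition, $\mathsf E$ is sharp, then $\mathsf P(\mathcal X)=\mathbb 1$, so that $[\mathsf E(x),N_S]=0$ for all $x\in\mathcal X$ (the repeatability part of the Wigner–Araki–Yanase theorem). -/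

import Mathlib

open scoped TensorProduct ComplexOrder InnerProductSpace

namespace QMeas

noncomputable section

/-! ### Trace-class operators and the trace -/

section TraceClass

variable {H : Type*} [NormedAddCommGroup H] [InnerProductSpace ℂ H]

/-- Trace-class (equivalently, nuclear) operators on a Hilbert space: norm-convergent sums
`∑ₙ |aₙ⟩⟨bₙ|` with `∑ₙ ‖aₙ‖ ‖bₙ‖ < ∞`. -/
def IsTraceClass (T : H →L[ℂ] H) : Prop :=
  ∃ a b : ℕ → H, Summable (fun n => ‖a n‖ * ‖b n‖) ∧
    HasSum (fun n => InnerProductSpace.rankOne ℂ (a n) (b n)) T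

theorem IsTraceClass.zero : IsTraceClass (0 : H →L[ℂ] H) :=
  ⟨fun _ => 0, fun _ => 0, by simp, by simp⟩

theorem IsTraceClass.smul (c : ℂ) {T : H →L[ℂ] H} (hT : IsTraceClass T) :
    IsTraceClass (c • T) := by
  obtain ⟨a, b, h, hs⟩ := hT
  refine ⟨fun n => c • a n, b, ?_, ?_⟩
  · simpa [norm_smul, mul_assoc] using h.mul_left ‖c‖
  · simpa using hs.const_smul c

theorem IsTraceClass.add {S T : H →L[ℂ] H} (hS : IsTraceClass S) (hT : IsTraceClass T) :
    IsTraceClass (S + T) := by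
  obtain ⟨a, b, h, hs⟩ := hS
  obtain ⟨a', b', h', hs'⟩ := hT
  let e := Equiv.natSumNatEquivNat
  refine ⟨fun n => Sum.elim a a' (e.symm n), fun n => Sum.elim b b' (e.symm n), ?_, ?_⟩
  · rw [← e.summable_iff]
    exact (HasSum.sum (f := fun i => ‖Sum.elim a a' (e.symm (e i))‖ *
      ‖Sum.elim b b' (e.symm (e i))‖) (by simpa [Function.comp_def] using h.hasSum) (by simpa [Function.comp_def] using h'.hasSum)).summable
  · rw [← e.hasSum_iff]
    exact HasSum.sum (f := fun i => InnerProductSpace.rankOne ℂ (Sum.elim a a' (e.symm (e i)))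
      (Sum.elim b b' (e.symm (e i)))) (by simpa [Function.comp_def] using hs) (by simpa [Function.comp_def] using hs')

variable (H) in
/-- The space `𝒯(H)` of trace-class operators. -/
def TraceClass : Submodule ℂ (H →L[ℂ] H) where
  carrier := {T | IsTraceClass T}
  zero_mem' := IsTraceClass.zero
  add_mem' := IsTraceClass.add
  smul_mem' c _ := IsTraceClass.smul c


/-- The sum of the diagonal entries of a trace-class operator along a Hilbert basis converges, to
a value that does not depend on the basis. -/
theorem hasSum_diagonal {T : H →L[ℂ] H} {a b : ℕ → H}
    (h : Summable (fun n => ‖a n‖ * ‖b n‖))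
    (hs : HasSum (fun n => InnerProductSpace.rankOne ℂ (a n) (b n)) T)
    {ι : Type*} (e : HilbertBasis ι ℂ H) :
    HasSum (fun i => ⟪e i, T (e i)⟫_ℂ) (∑' n, ⟪b n, a n⟫_ℂ) := by
  have parseval (x : H) : HasSum (fun i => ‖⟪x, e i⟫_ℂ‖ ^ (2 : ℝ)) (‖x‖ ^ (2 : ℝ)) := by
    have := (e.hasSum_inner_mul_inner x x).mapL Complex.reCLM
    have h2 (i : ι) : Complex.reCLM (⟪x, e i⟫_ℂ * ⟪e i, x⟫_ℂ) = ‖⟪x, e i⟫_ℂ‖ ^ (2 : ℝ) := by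
      rw [Real.rpow_two, ← inner_conj_symm (e i) x, Complex.mul_conj, Complex.reCLM_apply,
        Complex.ofReal_re, Complex.normSq_eq_norm_sq]
    simp only [h2] at this
    simpa [inner_self_eq_norm_sq_to_K, ← Complex.ofReal_pow] using this
  have cs (n : ℕ) := Real.summable_and_inner_le_Lp_mul_Lq_tsum_of_nonneg
    (f := fun i => ‖⟪b n, e i⟫_ℂ‖) (g := fun i => ‖⟪a n, e i⟫_ℂ‖) (p := 2) (q := 2)
    (Real.HolderConjugate.two_two) (fun _ => norm_nonneg _) (fun _ => norm_nonneg _)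
    (parseval _).summable (parseval _).summable
  have key (n : ℕ) (i : ι) : ‖⟪b n, e i⟫_ℂ * ⟪e i, a n⟫_ℂ‖ =
      ‖⟪b n, e i⟫_ℂ‖ * ‖⟪a n, e i⟫_ℂ‖ := by
    rw [norm_mul, norm_inner_symm (e i)]
  have hsum : Summable (fun q : ℕ × ι => ⟪b q.1, e q.2⟫_ℂ * ⟪e q.2, a q.1⟫_ℂ) := by
    apply Summable.of_norm
    rw [summable_prod_of_nonneg (fun _ => norm_nonneg _)]
    refine ⟨fun n => by simpa only [key] using (cs n).1, ?_⟩
    refine Summable.of_nonneg_of_le (fun n => tsum_nonneg fun _ => norm_nonneg _) (fun n => ?_) h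
    simp only [key]
    refine (cs n).2.trans (le_of_eq ?_)
    rw [(parseval _).tsum_eq, (parseval _).tsum_eq, ← Real.rpow_mul (norm_nonneg _),
      ← Real.rpow_mul (norm_nonneg _)]
    norm_num [mul_comm]
  have hcol (i : ι) : HasSum (fun n => ⟪b n, e i⟫_ℂ * ⟪e i, a n⟫_ℂ) ⟪e i, T (e i)⟫_ℂ := by
    have h1 := (hs.mapL ((ContinuousLinearMap.apply ℂ H) (e i))).mapL (innerSL ℂ (e i))
    simpa [inner_smul_right] using h1
  have h1 : HasSum (fun n => ⟪b n, a n⟫_ℂ)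
      (∑' q : ℕ × ι, ⟪b q.1, e q.2⟫_ℂ * ⟪e q.2, a q.1⟫_ℂ) :=
    hsum.hasSum.prod_fiberwise fun n => e.hasSum_inner_mul_inner (b n) (a n)
  rw [h1.tsum_eq]
  have h2 := (Equiv.prodComm ι ℕ).hasSum_iff.mpr hsum.hasSum
  exact h2.prod_fiberwise fun i => hcol i

variable [CompleteSpace H]

/-- The trace `∑ᵢ ⟨eᵢ, T eᵢ⟩` along a Hilbert basis. It is used for trace-class `T` only, for which
the choice of the basis is immaterial by `tr_eq_tsum`. -/
def tr (T : H →L[ℂ] H) : ℂ :=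
  ∑' i : (exists_hilbertBasis ℂ H).choose,
    ⟪(exists_hilbertBasis ℂ H).choose_spec.choose i,
      T ((exists_hilbertBasis ℂ H).choose_spec.choose i)⟫_ℂ

theorem tr_eq_tsum {T : H →L[ℂ] H} (hT : IsTraceClass T) {ι : Type*} (e : HilbertBasis ι ℂ H) :
    tr T = ∑' i, ⟪e i, T (e i)⟫_ℂ := by
  obtain ⟨a, b, h, hs⟩ := hT
  rw [(hasSum_diagonal h hs e).tsum_eq, tr]
  exact (hasSum_diagonal h hs _).tsum_eq

end TraceClass

/-! ### Tensor products -/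

section Tensor

variable {H K : Type*} [NormedAddCommGroup H] [InnerProductSpace ℂ H]
  [NormedAddCommGroup K] [InnerProductSpace ℂ K]

/-- If one factor is finite-dimensional, the algebraic tensor product of Hilbert spaces is
complete, hence it is the Hilbert space tensor product. -/
instance completeSpace_tensor [FiniteDimensional ℂ H] [CompleteSpace K] :
    CompleteSpace (H ⊗[ℂ] K) := by
  let e := stdOrthonormalBasis ℂ H
  let C (i) : H ⊗[ℂ] K →L[ℂ] K :=
    (TensorProduct.lidIsometry ℂ K).toContinuousLinearEquiv.toContinuousLinearMap ∘L
      (innerSL ℂ (e i)).rTensor K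
  have hC (z : H ⊗[ℂ] K) : ∑ i, e i ⊗ₜ[ℂ] C i z = z := by
    induction z with
    | zero => simp
    | tmul x y =>
      have h1 (i) : C i (x ⊗ₜ[ℂ] y) = ⟪e i, x⟫_ℂ • y := by simp [C]
      simp only [h1, ← TensorProduct.smul_tmul, ← TensorProduct.sum_tmul]
      congr 1
      exact e.sum_repr' x
    | add z w hz hw => simp only [map_add, TensorProduct.tmul_add, Finset.sum_add_distrib, hz, hw]
  refine Metric.complete_of_cauchySeq_tendsto fun u hu => ?_
  have hlim (i) : ∃ y, Filter.Tendsto (fun n => C i (u n)) Filter.atTop (nhds y) :=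
    cauchySeq_tendsto_of_complete (hu.map (C i).uniformContinuous)
  choose y hy using hlim
  refine ⟨∑ i, e i ⊗ₜ[ℂ] y i, ?_⟩
  have : Filter.Tendsto (fun n => ∑ i, e i ⊗ₜ[ℂ] C i (u n)) Filter.atTop
      (nhds (∑ i, e i ⊗ₜ[ℂ] y i)) :=
    tendsto_finsetSum _ fun i _ =>
      ((TensorProduct.mkL ℂ H K (e i)).continuous.tendsto (y i)).comp (hy i)
  simpa only [hC] using this

theorem hasSum_mapL_left {f : ℕ → (H →L[ℂ] H)} {S : H →L[ℂ] H} (hf : HasSum f S)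
    (T : K →L[ℂ] K) : HasSum (fun n => TensorProduct.mapL (f n) T) (TensorProduct.mapL S T) := by
  let L : (H →L[ℂ] H) →ₗ[ℂ] (H ⊗[ℂ] K →L[ℂ] H ⊗[ℂ] K) :=
    { toFun := fun S => TensorProduct.mapL S T
      map_add' := fun _ _ => TensorProduct.mapL_add_left _ _ _
      map_smul' := fun _ _ => TensorProduct.mapL_smul_left _ _ _ }
  have hb : ∀ S, ‖L S‖ ≤ ‖T‖ * ‖S‖ := fun S =>
    (TensorProduct.norm_mapL_le S T).trans_eq (mul_comm _ _)
  have hL : Continuous L := AddMonoidHomClass.continuous_of_bound L ‖T‖ hb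
  exact hf.map L hL

theorem hasSum_mapL_right (S : H →L[ℂ] H) {f : ℕ → (K →L[ℂ] K)} {T : K →L[ℂ] K}
    (hf : HasSum f T) :
    HasSum (fun n => TensorProduct.mapL S (f n)) (TensorProduct.mapL S T) := by
  let L : (K →L[ℂ] K) →ₗ[ℂ] (H ⊗[ℂ] K →L[ℂ] H ⊗[ℂ] K) :=
    { toFun := fun T => TensorProduct.mapL S T
      map_add' := fun _ _ => TensorProduct.mapL_add_right _ _ _
      map_smul' := fun _ _ => TensorProduct.mapL_smul_right _ _ _ }
  have hb : ∀ T, ‖L T‖ ≤ ‖S‖ * ‖T‖ := fun T => TensorProduct.norm_mapL_le S T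
  have hL : Continuous L := AddMonoidHomClass.continuous_of_bound L ‖S‖ hb
  exact hf.map L hL

theorem hasSum_of_rows {V : Type*} [NormedAddCommGroup V] [CompleteSpace V] {R : ℕ × ℕ → V}
    {g : ℕ × ℕ → ℝ} (hg : Summable g) (hR : ∀ q, ‖R q‖ ≤ g q) {r : ℕ → V} {s : V}
    (hr : ∀ n, HasSum (fun m => R (n, m)) (r n)) (hs : HasSum r s) : HasSum R s := by
  have h := (Summable.of_norm_bounded hg hR).hasSum
  rwa [(h.prod_fiberwise hr).unique hs] at h

theorem rankOne_tensor (x y : H) (z w : K) :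
    TensorProduct.mapL (InnerProductSpace.rankOne ℂ x y) (InnerProductSpace.rankOne ℂ z w) =
      InnerProductSpace.rankOne ℂ (x ⊗ₜ[ℂ] z) (y ⊗ₜ[ℂ] w) := by
  apply ContinuousLinearMap.coe_inj.mp
  apply TensorProduct.ext'
  intro p q
  simp [TensorProduct.smul_tmul', TensorProduct.tmul_smul, smul_smul, mul_comm]

theorem IsTraceClass.tensor [FiniteDimensional ℂ H] [CompleteSpace K] {S : H →L[ℂ] H}
    {T : K →L[ℂ] K} (hS : IsTraceClass S) (hT : IsTraceClass T) :
    IsTraceClass (TensorProduct.mapL S T) := by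
  obtain ⟨a, b, h, hs⟩ := hS
  obtain ⟨c, d, h', hs'⟩ := hT
  have hn : Summable (fun q : ℕ × ℕ => (‖a q.1‖ * ‖b q.1‖) * (‖c q.2‖ * ‖d q.2‖)) :=
    h.mul_of_nonneg h' (fun _ => by positivity) (fun _ => by positivity)
  let R (q : ℕ × ℕ) : H ⊗[ℂ] K →L[ℂ] H ⊗[ℂ] K :=
    InnerProductSpace.rankOne ℂ (a q.1 ⊗ₜ[ℂ] c q.2) (b q.1 ⊗ₜ[ℂ] d q.2)
  have hR (q : ℕ × ℕ) : ‖R q‖ ≤ (‖a q.1‖ * ‖b q.1‖) * (‖c q.2‖ * ‖d q.2‖) := by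
    simp only [R, InnerProductSpace.norm_rankOne, TensorProduct.norm_tmul]
    exact le_of_eq (by ring)
  have h1 (n : ℕ) : HasSum (fun m => R (n, m))
      (TensorProduct.mapL (InnerProductSpace.rankOne ℂ (a n) (b n)) T) := by
    have := hasSum_mapL_right (InnerProductSpace.rankOne ℂ (a n) (b n)) hs'
    simp only [rankOne_tensor] at this
    exact this
  have hval' := hasSum_mapL_left hs T
  have hval : HasSum R (TensorProduct.mapL S T) :=
    hasSum_of_rows (V := H ⊗[ℂ] K →L[ℂ] H ⊗[ℂ] K) (r := fun n =>
      TensorProduct.mapL (InnerProductSpace.rankOne ℂ (a n) (b n)) T) hn hR h1 hval'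
  refine ⟨fun n => a (Nat.pairEquiv.symm n).1 ⊗ₜ[ℂ] c (Nat.pairEquiv.symm n).2,
    fun n => b (Nat.pairEquiv.symm n).1 ⊗ₜ[ℂ] d (Nat.pairEquiv.symm n).2, ?_, ?_⟩
  · refine (Nat.pairEquiv.symm.summable_iff.mpr hn).congr fun n => ?_
    simp only [Function.comp_apply, TensorProduct.norm_tmul]
    ring
  · have := Nat.pairEquiv.symm.hasSum_iff.mpr hval
    exact this

/-- The product `S ⊗ T` of trace-class operators. -/
def TraceClass.tensor [FiniteDimensional ℂ H] [CompleteSpace K] (S : TraceClass H) (T : TraceClass K) : TraceClass (H ⊗[ℂ] K) :=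
  ⟨TensorProduct.mapL S.1 T.1, S.2.tensor T.2⟩

/-- `R = tr_K[S]`: the partial trace over the second factor, characterised by
`tr[A tr_K[S]] = tr[(A ⊗ 1) S]` for all bounded `A`. -/
def IsPartialTrace [FiniteDimensional ℂ H] [CompleteSpace H] [CompleteSpace K]
    (S : H ⊗[ℂ] K →L[ℂ] H ⊗[ℂ] K) (R : H →L[ℂ] H) : Prop :=
  ∀ A : H →L[ℂ] H, tr (A * R) = tr (TensorProduct.mapL A 1 * S)

/-- The additive quantity `N_H ⊗ 1 + 1 ⊗ N_K`. -/
def additive (NH : H →L[ℂ] H) (NK : K →L[ℂ] K) : H ⊗[ℂ] K →L[ℂ] H ⊗[ℂ] K :=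
  TensorProduct.mapL NH 1 + TensorProduct.mapL 1 NK

end Tensor

/-! ### States, operations, channels, conservation laws -/

section Channels

variable {H K : Type*} [NormedAddCommGroup H] [InnerProductSpace ℂ H]
  [NormedAddCommGroup K] [InnerProductSpace ℂ K]

/-- Positivity of the operator matrix `(T i j)` as an operator on `H ⊗ ℂⁿ = Hⁿ`. -/
def BlockPositive {n : ℕ} (T : Fin n → Fin n → (H →L[ℂ] H)) : Prop :=
  ∀ v : Fin n → H, 0 ≤ ∑ i, ∑ j, ⟪v i, T i j (v j)⟫_ℂ

/-- Complete positivity: all amplifications `Φ ⊗ id` to `n × n` matrices preserve positivity. -/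
def IsCompletelyPositive (Φ : TraceClass H →ₗ[ℂ] TraceClass K) : Prop :=
  ∀ (n : ℕ) (T : Fin n → Fin n → TraceClass H),
    BlockPositive (fun i j => (T i j : H →L[ℂ] H)) →
      BlockPositive (fun i j => (Φ (T i j) : K →L[ℂ] K))

variable [CompleteSpace H] [CompleteSpace K]

/-- States: positive trace-class operators of unit trace. -/
def IsState (ρ : TraceClass H) : Prop :=
  0 ≤ (ρ : H →L[ℂ] H) ∧ tr (ρ : H →L[ℂ] H) = 1

/-- Operations: completely positive, trace non-increasing linear maps. -/
def IsOperation (Φ : TraceClass H →ₗ[ℂ] TraceClass K) : Prop :=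
  IsCompletelyPositive Φ ∧
    ∀ T : TraceClass H, 0 ≤ (T : H →L[ℂ] H) → tr (Φ T : K →L[ℂ] K) ≤ tr (T : H →L[ℂ] H)

/-- Channels: completely positive, trace-preserving linear maps. -/
def IsChannel (Φ : TraceClass H →ₗ[ℂ] TraceClass K) : Prop :=
  IsCompletelyPositive Φ ∧ ∀ T : TraceClass H, tr (Φ T : K →L[ℂ] K) = tr (T : H →L[ℂ] H)

/-- `Φ` conserves `N` on average: `tr[N Φ(ρ)] = tr[N ρ]` for all states `ρ`. -/
def ConservesOnAverage (Φ : TraceClass H →ₗ[ℂ] TraceClass H) (N : H →L[ℂ] H) : Prop :=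
  ∀ ρ : TraceClass H, IsState ρ →
    tr (N * (Φ ρ : H →L[ℂ] H)) = tr (N * (ρ : H →L[ℂ] H))

end Channels

/-! ### Observables, instruments, measurement schemes -/

section Measurement

variable {X H K : Type*} [NormedAddCommGroup H] [InnerProductSpace ℂ H]
  [NormedAddCommGroup K] [InnerProductSpace ℂ K]

/-- Discrete observables: positive operators `E x` with `∑ₓ E x = 1` in the strong operator
topology. -/
def IsObservable (E : X → (H →L[ℂ] H)) : Prop :=
  (∀ x, 0 ≤ E x) ∧ ∀ ψ : H, HasSum (fun x => E x ψ) ψ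

open scoped Classical in
/-- Sharp observables: `E(x) E(y) = δ_{x,y} E(x)`. -/
def IsSharp (E : X → (H →L[ℂ] H)) : Prop :=
  ∀ x y, E x * E y = if x = y then E x else 0

/-- The projection `P(x)` onto the eigenvalue-1 eigenspace of the effect `E(x)`. -/
def certaintyProjection [FiniteDimensional ℂ H] (E : X → (H →L[ℂ] H)) (x : X) : H →L[ℂ] H :=
  (Module.End.eigenspace (E x : H →ₗ[ℂ] H) 1).starProjection

/-- `P(𝒳) = ∑ₓ P(x)`. -/
def totalCertaintyProjection [FiniteDimensional ℂ H] (E : X → (H →L[ℂ] H)) : H →L[ℂ] H :=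
  ∑' x, certaintyProjection E x

variable [CompleteSpace H] [CompleteSpace K]

/-- Discrete instruments: operations `I x` whose sum over all outcomes is a channel. -/
def IsInstrument (I : X → (TraceClass H →ₗ[ℂ] TraceClass H)) : Prop :=
  (∀ x, IsOperation (I x)) ∧ ∃ Φ : TraceClass H →ₗ[ℂ] TraceClass H, IsChannel Φ ∧
    ∀ T : TraceClass H, HasSum (fun x => (I x T : H →L[ℂ] H)) (Φ T : H →L[ℂ] H)

/-- `I` is an `E`-instrument: `tr[I_x(T)] = tr[E(x) T]`, that is, `I_x^*(1) = E(x)`. -/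
def IsInstrumentFor (E : X → (H →L[ℂ] H)) (I : X → (TraceClass H →ₗ[ℂ] TraceClass H)) : Prop :=
  IsInstrument I ∧
    ∀ x (T : TraceClass H), tr (I x T : H →L[ℂ] H) = tr (E x * (T : H →L[ℂ] H))

open scoped Classical in
/-- Repeatability: `tr[I_y(I_x(ρ))] = δ_{x,y} tr[I_x(ρ)]` for all states and outcomes. -/
def IsRepeatable (I : X → (TraceClass H →ₗ[ℂ] TraceClass H)) : Prop :=
  ∀ ρ : TraceClass H, IsState ρ → ∀ x y,
    tr (I y (I x ρ) : H →L[ℂ] H) = if x = y then tr (I x ρ : H →L[ℂ] H) else 0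

variable (X H K) in
/-- Measurement schemes on the system `H` with apparatus space `K`: an apparatus state, an
interaction channel of system and apparatus, and a pointer observable. -/
structure MeasurementScheme [FiniteDimensional ℂ H] where
  apparatusState : TraceClass K
  isState : IsState apparatusState
  interaction : TraceClass (H ⊗[ℂ] K) →ₗ[ℂ] TraceClass (H ⊗[ℂ] K)
  isChannel : IsChannel interaction
  pointer : X → (K →L[ℂ] K)
  isObservable : IsObservable pointer

/-- `M` implements `I`: `I_x(T) = tr_K[(1 ⊗ Z(x)) 𝓔(T ⊗ ξ)]`. -/
def MeasurementScheme.Implements [FiniteDimensional ℂ H] (M : MeasurementScheme X H K)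
    (I : X → (TraceClass H →ₗ[ℂ] TraceClass H)) : Prop :=
  ∀ x (T : TraceClass H), IsPartialTrace
    (TensorProduct.mapL 1 (M.pointer x) *
      (M.interaction (TraceClass.tensor T M.apparatusState) : H ⊗[ℂ] K →L[ℂ] H ⊗[ℂ] K))
    (I x T : H →L[ℂ] H)

end Measurement

end

end QMeas

open QMeas

/-! Take unit vectors `φ`, `ψ` on which outcomes `x ≠ y` are certain. Applying the interaction to
the operators `|vᵢ⟩⟨vⱼ| ⊗ ξ`, `v = (φ, ψ)`, gives by complete positivity a positive `2 × 2` block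
matrix `S`, and polarised conservation (`MeasurementScheme.tr_interaction_rankOne`) gives `tr[N S₀₁]
= ⟪ψ, N_S φ⟫`, the apparatus term dropping out because `φ ⊥ ψ`. Both terms on the left vanish by
`BlockPositive.tr_mul_eq_zero`: if two exclusive effects are certain in `S₀₀` and `S₁₁`, then `S₀₁`
has no trace against anything commuting with the second effect. For `N_S ⊗ 1` the effects are the
pointer effects `1 ⊗ Z`, certain because `E` is. For `1 ⊗ N_A` they are `E ⊗ 1`, certain after the
interaction by repeatability. Thus `N_S` has no matrix elements between distinct certainty subspaces
(`inner_eq_zero_of_repeatable`), and its compression is block diagonal. -/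

namespace QMeas

/-! ### Trace calculus and positive operators -/

section TraceClassLemmas

variable {H : Type*} [NormedAddCommGroup H] [InnerProductSpace ℂ H]

theorem IsTraceClass.rankOne (x y : H) : IsTraceClass (InnerProductSpace.rankOne ℂ x y) := by
  refine ⟨Pi.single 0 x, Pi.single 0 y, ?_, ?_⟩
  · exact summable_of_ne_finset_zero (s := {0}) fun n hn => by
      simp [Pi.single_eq_of_ne (by simpa using hn : n ≠ 0)]
  · convert! hasSum_single (f := fun n => InnerProductSpace.rankOne ℂ
      ((Pi.single 0 x : ℕ → H) n) ((Pi.single 0 y : ℕ → H) n)) 0 fun n hn => by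
        simp [Pi.single_eq_of_ne hn]

theorem IsTraceClass.mul_left {T : H →L[ℂ] H} (hT : IsTraceClass T) (B : H →L[ℂ] H) :
    IsTraceClass (B * T) := by
  obtain ⟨a, b, h, hs⟩ := hT
  refine ⟨fun n => B (a n), b, ?_, ?_⟩
  · refine Summable.of_nonneg_of_le (fun n => by positivity) (fun n => ?_) (h.mul_left ‖B‖)
    rw [← mul_assoc]
    gcongr
    exact B.le_opNorm _
  · simpa [ContinuousLinearMap.mul_def, InnerProductSpace.comp_rankOne] using hs.mul_left B

variable [CompleteSpace H]

theorem IsTraceClass.mul_right {T : H →L[ℂ] H} (hT : IsTraceClass T) (B : H →L[ℂ] H) :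
    IsTraceClass (T * B) := by
  obtain ⟨a, b, h, hs⟩ := hT
  refine ⟨a, fun n => B.adjoint (b n), ?_, ?_⟩
  · refine Summable.of_nonneg_of_le (fun n => by positivity) (fun n => ?_) (h.mul_left ‖B‖)
    rw [mul_left_comm]
    gcongr
    exact (B.adjoint.le_opNorm _).trans_eq (by simp)
  · simpa [ContinuousLinearMap.mul_def, InnerProductSpace.rankOne_comp] using hs.mul_right B

/-- Any nuclear decomposition may be used, so identities such as cyclicity reduce to termwise ones.
-/
theorem tr_eq_of_hasSum {T : H →L[ℂ] H} {a b : ℕ → H}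
    (h : Summable (fun n => ‖a n‖ * ‖b n‖))
    (hs : HasSum (fun n => InnerProductSpace.rankOne ℂ (a n) (b n)) T) :
    tr T = ∑' n, ⟪b n, a n⟫_ℂ :=
  (hasSum_diagonal h hs _).tsum_eq

theorem IsTraceClass.hasSum_tr {T : H →L[ℂ] H} (hT : IsTraceClass T) {ι : Type*}
    (e : HilbertBasis ι ℂ H) : HasSum (fun i => ⟪e i, T (e i)⟫_ℂ) (tr T) := by
  obtain ⟨a, b, h, hs⟩ := hT
  rw [tr_eq_of_hasSum h hs]
  exact hasSum_diagonal h hs e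

theorem tr_add {S T : H →L[ℂ] H} (hS : IsTraceClass S) (hT : IsTraceClass T) :
    tr (S + T) = tr S + tr T := by
  obtain ⟨w, e, he⟩ := exists_hilbertBasis ℂ H
  refine ((hS.add hT).hasSum_tr e).unique ?_
  simpa [inner_add_right] using (hS.hasSum_tr e).add (hT.hasSum_tr e)

theorem tr_smul (c : ℂ) {T : H →L[ℂ] H} (hT : IsTraceClass T) :
    tr (c • T) = c * tr T := by
  obtain ⟨w, e, he⟩ := exists_hilbertBasis ℂ H
  refine ((hT.smul c).hasSum_tr e).unique ?_
  simpa [inner_smul_right] using (hT.hasSum_tr e).mul_left c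

theorem tr_zero : tr (0 : H →L[ℂ] H) = 0 := by simp [tr]

theorem tr_sub {S T : H →L[ℂ] H} (hS : IsTraceClass S) (hT : IsTraceClass T) :
    tr (S - T) = tr S - tr T := by
  have := tr_add hS (hT.smul (-1))
  rw [tr_smul _ hT] at this
  simpa [sub_eq_add_neg] using this

/-- Cyclicity of the trace. -/
theorem tr_mul_comm (B : H →L[ℂ] H) {T : H →L[ℂ] H} (hT : IsTraceClass T) :
    tr (B * T) = tr (T * B) := by
  obtain ⟨a, b, h, hs⟩ := hT
  have h1 : HasSum (fun n => InnerProductSpace.rankOne ℂ (B (a n)) (b n)) (B * T) := by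
    simpa [ContinuousLinearMap.mul_def, InnerProductSpace.comp_rankOne] using hs.mul_left B
  have h2 : HasSum (fun n => InnerProductSpace.rankOne ℂ (a n) (B.adjoint (b n))) (T * B) := by
    simpa [ContinuousLinearMap.mul_def, InnerProductSpace.rankOne_comp] using hs.mul_right B
  rw [tr_eq_of_hasSum _ h1, tr_eq_of_hasSum _ h2]
  · simp [ContinuousLinearMap.adjoint_inner_left]
  · refine Summable.of_nonneg_of_le (fun n => by positivity) (fun n => ?_) (h.mul_left ‖B‖)
    rw [mul_left_comm]
    gcongr
    exact (B.adjoint.le_opNorm _).trans_eq (by simp)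
  · refine Summable.of_nonneg_of_le (fun n => by positivity) (fun n => ?_) (h.mul_left ‖B‖)
    rw [← mul_assoc]
    gcongr
    exact B.le_opNorm _

theorem tr_rankOne (x y : H) : tr (InnerProductSpace.rankOne ℂ x y) = ⟪y, x⟫_ℂ := by
  obtain ⟨w, e, he⟩ := exists_hilbertBasis ℂ H
  refine ((IsTraceClass.rankOne x y).hasSum_tr e).unique ?_
  simpa [inner_smul_right, mul_comm] using e.hasSum_inner_mul_inner y x

theorem exists_eq_adjoint_mul_self {T : H →L[ℂ] H} (hT : 0 ≤ T) :
    ∃ R : H →L[ℂ] H, T = R.adjoint * R := by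
  obtain ⟨R, hR⟩ := CStarAlgebra.nonneg_iff_eq_star_mul_self.mp hT
  exact ⟨R, hR⟩

theorem adjoint_mul_self_nonneg (R : H →L[ℂ] H) : 0 ≤ R.adjoint * R :=
  (ContinuousLinearMap.nonneg_iff_isPositive _).mpr R.isPositive_adjoint_comp_self

omit [CompleteSpace H] in
theorem inner_nonneg_of_nonneg {T : H →L[ℂ] H} (hT : 0 ≤ T) (v : H) : 0 ≤ ⟪v, T v⟫_ℂ :=
  ((ContinuousLinearMap.nonneg_iff_isPositive _).mp hT).inner_nonneg_right v

omit [CompleteSpace H] in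
-- The order on `ℂ` makes the form real-valued, and over `ℂ` this already forces symmetry.
theorem nonneg_of_inner_nonneg {T : H →L[ℂ] H} (hT : ∀ v, 0 ≤ ⟪v, T v⟫_ℂ) : 0 ≤ T := by
  rw [ContinuousLinearMap.nonneg_iff_isPositive, ContinuousLinearMap.isPositive_iff_complex]
  intro v
  have h := hT v
  have h2 : ⟪T v, v⟫_ℂ = ⟪v, T v⟫_ℂ := by
    rw [← inner_conj_symm, RCLike.conj_eq_iff_im]
    exact (Complex.nonneg_iff.mp h).2.symm
  rw [h2]
  exact ⟨Complex.ext (by simp) (by simpa using (Complex.nonneg_iff.mp h).2),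
    (Complex.nonneg_iff.mp h).1⟩

/-- A positive operator maps the vectors on which its quadratic form vanishes to zero. -/
theorem apply_eq_zero_of_inner_eq_zero {T : H →L[ℂ] H} (hT : 0 ≤ T) {v : H}
    (h : ⟪v, T v⟫_ℂ = 0) : T v = 0 := by
  obtain ⟨R, rfl⟩ := exists_eq_adjoint_mul_self hT
  have : R v = 0 := by
    rw [mul_apply_eq_comp, ContinuousLinearMap.adjoint_inner_right] at h
    exact inner_self_eq_zero.mp h
  simp [this]

/-- The diagonal entries are nonnegative with sum zero, so each vanishes and `T` kills every basis
vector. -/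
theorem eq_zero_of_tr_eq_zero {T : H →L[ℂ] H} (hT : 0 ≤ T) (hT' : IsTraceClass T)
    (h : tr T = 0) : T = 0 := by
  obtain ⟨w, e, he⟩ := exists_hilbertBasis ℂ H
  have hs := hT'.hasSum_tr e
  rw [h] at hs
  have h0 := (hasSum_zero_iff_of_nonneg fun i => inner_nonneg_of_nonneg hT (e i)).mp hs
  have hz (i) : T (e i) = 0 := apply_eq_zero_of_inner_eq_zero hT (congrFun h0 i)
  refine ContinuousLinearMap.ext_on (s := Set.range e) ?_ ?_
  · rw [Submodule.dense_iff_topologicalClosure_eq_top]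
    exact e.dense_span
  · rintro _ ⟨i, rfl⟩
    simpa using hz i

/-- If `tr[B S] = 0` for positive `B` and `S`, then `S B = 0`. -/
theorem mul_eq_zero_of_tr_mul_eq_zero {B S : H →L[ℂ] H} (hB : 0 ≤ B) (hS : 0 ≤ S)
    (hS' : IsTraceClass S) (h : tr (B * S) = 0) : S * B = 0 := by
  obtain ⟨R, rfl⟩ := exists_eq_adjoint_mul_self hB
  obtain ⟨Q, hQ⟩ := exists_eq_adjoint_mul_self hS
  -- With `B = R*R` and `S = Q*Q`, cyclicity turns the trace into that of the positive operator
  -- `(QR*)*(QR*)`, whence `QR* = 0`.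
  have h1 : tr (R * S * R.adjoint) = 0 := by
    rw [← tr_mul_comm _ (hS'.mul_left R), ← mul_assoc, h]
  have hp : R * S * R.adjoint = (Q * R.adjoint).adjoint * (Q * R.adjoint) := by
    rw [hQ]
    simp [ContinuousLinearMap.mul_def, ContinuousLinearMap.adjoint_comp,
      ContinuousLinearMap.comp_assoc]
  have h2 := eq_zero_of_tr_eq_zero (hp ▸ adjoint_mul_self_nonneg _)
    ((hS'.mul_left R).mul_right _) h1
  have h3 : Q * R.adjoint = 0 := by
    rw [hp] at h2
    exact CStarRing.star_mul_self_eq_zero_iff _ |>.mp h2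
  rw [hQ, mul_assoc, ← mul_assoc Q, h3, zero_mul, mul_zero]

end TraceClassLemmas

/-! ### Off-diagonal blocks of positive block matrices -/

section BlockPositivity

variable {H : Type*} [NormedAddCommGroup H] [InnerProductSpace ℂ H]

/-- A real-affine function bounded below is constant. Reality at `c = 0, 1, i` gives `β = conj α`.
-/
theorem eq_zero_of_bounded_below {α β γ : ℂ}
    (h : ∀ c : ℂ, 0 ≤ α * (starRingEnd ℂ) c + c * β + γ) : α = 0 ∧ β = 0 := by
  simp only [Complex.nonneg_iff, Complex.add_re, Complex.add_im, Complex.mul_re, Complex.mul_im,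
    Complex.conj_re, Complex.conj_im] at h
  have h0 := h 0
  have h1 := h 1
  have hI := h Complex.I
  simp only [Complex.zero_re, Complex.zero_im, Complex.one_re, Complex.one_im, Complex.I_re,
    Complex.I_im] at h0 h1 hI
  have hre : α.re = β.re := by linarith
  have him : α.im = -β.im := by linarith
  have hα : α.re = 0 := by
    by_contra hne
    -- At this `c`, as at the imaginary one below, the real part would be `-1`.
    have := (h ((-(γ.re + 1) / (2 * α.re) : ℝ) : ℂ)).1
    simp only [Complex.ofReal_re, Complex.ofReal_im, ← hre] at this
    field_simp at this
    linarith
  have hα' : α.im = 0 := by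
    by_contra hne
    have := (h (((-(γ.re + 1) / (2 * α.im) : ℝ) : ℂ) * Complex.I)).1
    have ht : -(γ.re + 1) / (2 * α.im) * α.im = -(γ.re + 1) / 2 := by field_simp
    have hβ : β.im = -α.im := by linarith
    simp only [Complex.mul_re, Complex.mul_im, Complex.ofReal_re, Complex.ofReal_im,
      Complex.I_re, Complex.I_im, hβ] at this
    linarith
  exact ⟨Complex.ext hα hα', Complex.ext (by simp [← hre, hα]) (by simp; linarith)⟩

/-- Carries facts about `S 0 0` and `S 1 0` over to `S 1 1` and `S 0 1`. -/
theorem BlockPositive.swap {S : Fin 2 → Fin 2 → (H →L[ℂ] H)} (h : BlockPositive S) :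
    BlockPositive (fun i j => S (Equiv.swap 0 1 i) (Equiv.swap 0 1 j)) := by
  intro v
  convert! h (v ∘ Equiv.swap 0 1) using 1
  simp [Fin.sum_univ_two]
  ring

theorem BlockPositive.diag_zero {S : Fin 2 → Fin 2 → (H →L[ℂ] H)} (h : BlockPositive S) (u : H) :
    0 ≤ ⟪u, S 0 0 u⟫_ℂ := by
  simpa [Fin.sum_univ_two] using h ![u, 0]

/-- If the first diagonal block annihilates the range of `B`, so does the block below it. -/
theorem BlockPositive.mul_eq_zero {S : Fin 2 → Fin 2 → (H →L[ℂ] H)} (h : BlockPositive S)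
    {B : H →L[ℂ] H} (hB : S 0 0 * B = 0) : S 1 0 * B = 0 := by
  ext u
  have hu : S 0 0 (B u) = 0 := congr($hB u)
  refine ext_inner_left ℂ fun w => ?_
  -- On the vector `(c • B u, w)` the `|c|²` term of the form vanishes by `hu`, leaving an affine
  -- function of `c`.
  have := (eq_zero_of_bounded_below (α := ⟪B u, S 0 1 w⟫_ℂ) (β := ⟪w, S 1 0 (B u)⟫_ℂ)
    (γ := ⟪w, S 1 1 w⟫_ℂ) fun c => by
      simpa [Fin.sum_univ_two, inner_smul_left, inner_smul_right, hu, add_assoc]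
        using h ![c • B u, w]).2
  simpa using this

variable [CompleteSpace H]

/-- If the first diagonal block annihilates the range of a self-adjoint `B`, then `B` annihilates
the range of the block to its right. -/
theorem BlockPositive.mul_eq_zero' {S : Fin 2 → Fin 2 → (H →L[ℂ] H)} (h : BlockPositive S)
    {B : H →L[ℂ] H} (hB' : IsSelfAdjoint B) (hB : S 0 0 * B = 0) : B * S 0 1 = 0 := by
  ext w
  refine ext_inner_left ℂ fun u => ?_
  have hu : S 0 0 (B u) = 0 := congr($hB u)
  have := (eq_zero_of_bounded_below (α := ⟪B u, S 0 1 w⟫_ℂ) (β := ⟪w, S 1 0 (B u)⟫_ℂ)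
    (γ := ⟪w, S 1 1 w⟫_ℂ) fun c => by
      simpa [Fin.sum_univ_two, inner_smul_left, inner_smul_right, hu, add_assoc]
        using h ![c • B u, w]).1
  have hs : ⟪u, B (S 0 1 w)⟫_ℂ = ⟪B u, S 0 1 w⟫_ℂ := (hB'.isSymmetric u _).symm
  simpa [hs] using this

/-- If positive `F`, `G` with `F + G ≤ 1` occur with certainty in the diagonal blocks of a
positive trace-class block matrix, then `tr[N S₀₁] = 0` for all `N` commuting with `G`. -/
theorem BlockPositive.tr_mul_eq_zero {S : Fin 2 → Fin 2 → (H →L[ℂ] H)} (h : BlockPositive S)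
    (hS : ∀ i j, IsTraceClass (S i j)) {F G N : H →L[ℂ] H} (hF : 0 ≤ F) (hG : 0 ≤ G)
    (hFG : F + G ≤ 1) (hF1 : tr (F * S 0 0) = tr (S 0 0)) (hG1 : tr (G * S 1 1) = tr (S 1 1))
    (hN : Commute N G) : tr (N * S 0 1) = 0 := by
  have p0 : 0 ≤ S 0 0 := nonneg_of_inner_nonneg h.diag_zero
  have p1 : 0 ≤ S 1 1 := nonneg_of_inner_nonneg fun v => by simpa using h.swap.diag_zero v
  -- Certainty of `F` in `S₀₀` makes `1 - F` kill the range of `S₀₁`; so does `G`, as `0 ≤ G ≤ 1 -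
  -- F`.
  have hG0 : G * S 0 1 = 0 := by
    have hle : G ≤ 1 - F := le_sub_iff_add_le'.mpr hFG
    have hS0 : S 0 0 * (1 - F) = 0 := by
      refine mul_eq_zero_of_tr_mul_eq_zero (hG.trans hle) p0 (hS 0 0) ?_
      rw [sub_mul, one_mul, tr_sub (hS 0 0) ((hS 0 0).mul_left F), hF1, sub_self]
    have h1 : (1 - F) * S 0 1 = 0 := h.mul_eq_zero' (IsSelfAdjoint.of_nonneg (hG.trans hle)) hS0
    ext v
    refine apply_eq_zero_of_inner_eq_zero hG (le_antisymm ?_ (inner_nonneg_of_nonneg hG _))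
    have h2 := inner_nonneg_of_nonneg (sub_nonneg.mpr hle) (S 0 1 v)
    have h3 : (1 - F) (S 0 1 v) = 0 := congr($h1 v)
    rw [sub_apply, h3, zero_sub, inner_neg_right] at h2
    exact neg_nonneg.mp h2
  have hG2 : S 0 1 * G = S 0 1 := by
    have hle : 0 ≤ 1 - G := sub_nonneg.mpr ((le_add_of_nonneg_left hF).trans hFG)
    have hS1 : S 1 1 * (1 - G) = 0 := by
      refine mul_eq_zero_of_tr_mul_eq_zero hle p1 (hS 1 1) ?_
      rw [sub_mul, one_mul, tr_sub (hS 1 1) ((hS 1 1).mul_left G), hG1, sub_self]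
    have h1 : S 0 1 * (1 - G) = 0 := by
      simpa using h.swap.mul_eq_zero (B := 1 - G) (by simpa using hS1)
    rw [mul_sub, mul_one, sub_eq_zero] at h1
    exact h1.symm
  -- `tr[N S₀₁] = tr[N S₀₁ G] = tr[G N S₀₁] = tr[N G S₀₁] = 0`.
  rw [← hG2, ← mul_assoc, ← tr_mul_comm _ ((hS 0 1).mul_left N), ← mul_assoc, ← hN.eq, mul_assoc,
    hG0, mul_zero, tr_zero]

end BlockPositivity

/-! ### Trace and positivity on tensor products -/

section TensorLemmas

variable {H K : Type*} [NormedAddCommGroup H] [InnerProductSpace ℂ H] [FiniteDimensional ℂ H]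
  [NormedAddCommGroup K] [InnerProductSpace ℂ K] [CompleteSpace K]

theorem tr_mapL_rankOne (x y : H) {T : K →L[ℂ] K} (hT : IsTraceClass T) :
    tr (TensorProduct.mapL (InnerProductSpace.rankOne ℂ x y) T) = ⟪y, x⟫_ℂ * tr T := by
  obtain ⟨c, d, h, hs⟩ := hT
  have h1 := hasSum_mapL_right (InnerProductSpace.rankOne ℂ x y) hs
  simp only [rankOne_tensor] at h1
  rw [tr_eq_of_hasSum h hs, tr_eq_of_hasSum _ h1]
  · simp [tsum_mul_left]
  · refine (h.mul_left (‖x‖ * ‖y‖)).congr fun n => ?_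
    simp only [TensorProduct.norm_tmul]
    ring

variable [CompleteSpace H]

theorem mapL_nonneg {A : H →L[ℂ] H} {B : K →L[ℂ] K} (hA : 0 ≤ A) (hB : 0 ≤ B) :
    0 ≤ TensorProduct.mapL A B := by
  obtain ⟨R, rfl⟩ := exists_eq_adjoint_mul_self hA
  obtain ⟨Q, rfl⟩ := exists_eq_adjoint_mul_self hB
  rw [TensorProduct.mapL_mul, ← TensorProduct.adjoint_mapL]
  exact adjoint_mul_self_nonneg _

omit [FiniteDimensional ℂ H] [CompleteSpace K] [CompleteSpace H] in
theorem mapL_one_one : TensorProduct.mapL (1 : H →L[ℂ] H) (1 : K →L[ℂ] K) = 1 :=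
  TensorProduct.mapL_id_id

theorem mapL_left_add_le_one {F G : H →L[ℂ] H} (h : F + G ≤ 1) :
    TensorProduct.mapL F (1 : K →L[ℂ] K) + TensorProduct.mapL G 1 ≤ 1 := by
  have := mapL_nonneg (sub_nonneg.mpr h) (zero_le_one (α := K →L[ℂ] K))
  have h2 : TensorProduct.mapL (1 - (F + G)) (1 : K →L[ℂ] K) + TensorProduct.mapL (F + G) 1 = 1 := by
    rw [← TensorProduct.mapL_add_left, sub_add_cancel, mapL_one_one]
  rw [← TensorProduct.mapL_add_left, ← h2]
  exact le_add_of_nonneg_left this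

theorem mapL_right_add_le_one {F G : K →L[ℂ] K} (h : F + G ≤ 1) :
    TensorProduct.mapL (1 : H →L[ℂ] H) F + TensorProduct.mapL 1 G ≤ 1 := by
  have := mapL_nonneg (zero_le_one (α := H →L[ℂ] H)) (sub_nonneg.mpr h)
  have h2 : TensorProduct.mapL (1 : H →L[ℂ] H) (1 - (F + G)) + TensorProduct.mapL 1 (F + G) = 1 := by
    rw [← TensorProduct.mapL_add_right, sub_add_cancel, mapL_one_one]
  rw [← TensorProduct.mapL_add_right, ← h2]
  exact le_add_of_nonneg_left this

omit [FiniteDimensional ℂ H] [CompleteSpace K] [CompleteSpace H] in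
theorem commute_mapL (A : H →L[ℂ] H) (B : K →L[ℂ] K) :
    Commute (TensorProduct.mapL A 1) (TensorProduct.mapL 1 B) := by
  simp [Commute, SemiconjBy, ← TensorProduct.mapL_mul]

/-- For `T = R*R` and a unit vector `u`, the blocks are `Aᵢ* Aⱼ` with `Aᵢ = |u⟩⟨φᵢ| ⊗ R`: a Gram
matrix. -/
theorem blockPositive_rankOne_tensor {n : ℕ} (φ : Fin n → H) {T : K →L[ℂ] K} (hT : 0 ≤ T) :
    BlockPositive fun i j =>
      TensorProduct.mapL (InnerProductSpace.rankOne ℂ (φ i) (φ j)) T := by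
  obtain ⟨R, rfl⟩ := exists_eq_adjoint_mul_self hT
  intro v
  -- Without a unit vector `H` is trivial and every block vanishes.
  by_cases hH : ∃ u : H, ‖u‖ = 1
  · obtain ⟨u, hu⟩ := hH
    let A (i : Fin n) := TensorProduct.mapL (InnerProductSpace.rankOne ℂ u (φ i)) R
    have hA (i j : Fin n) : TensorProduct.mapL (InnerProductSpace.rankOne ℂ (φ i) (φ j))
        (R.adjoint * R) = (A i).adjoint * A j := by
      rw [TensorProduct.adjoint_mapL, ← TensorProduct.mapL_mul]
      simp [ContinuousLinearMap.mul_def, InnerProductSpace.comp_rankOne, hu]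
    have : ∑ i, ∑ j, ⟪v i, TensorProduct.mapL (InnerProductSpace.rankOne ℂ (φ i) (φ j))
        (R.adjoint * R) (v j)⟫_ℂ = ⟪∑ i, A i (v i), ∑ j, A j (v j)⟫_ℂ := by
      simp only [hA, mul_apply_eq_comp, ContinuousLinearMap.adjoint_inner_right, sum_inner,
        inner_sum]
      exact Finset.sum_comm
    rw [this]
    simp
  · have (i : Fin n) : φ i = 0 := by
      by_contra h
      exact hH ⟨(‖φ i‖⁻¹ : ℂ) • φ i, by simp [norm_smul, h]⟩
    simp [this]

end TensorLemmas

/-! ### Exclusive outcomes of an observable -/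

section Observables

variable {X H : Type*} [NormedAddCommGroup H] [InnerProductSpace ℂ H]

theorem IsObservable.add_le_one [CompleteSpace H] {E : X → (H →L[ℂ] H)}
    (hE : IsObservable E) {x y : X} (hxy : x ≠ y) :
    E x + E y ≤ 1 := by
  classical
  refine sub_nonneg.mp (nonneg_of_inner_nonneg fun ψ => ?_)
  have hs := (hE.2 ψ).mapL (innerSL ℂ ψ)
  have := sum_le_hasSum {x, y} (fun z _ => inner_nonneg_of_nonneg (hE.1 z) ψ) hs
  rw [Finset.sum_pair hxy] at this
  simpa [inner_sub_right, inner_add_right] using this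

theorem IsObservable.apply_eq_zero [CompleteSpace H] {E : X → (H →L[ℂ] H)} (hE : IsObservable E)
    {x y : X} (hxy : x ≠ y) {φ : H} (h : E x φ = φ) : E y φ = 0 := by
  refine apply_eq_zero_of_inner_eq_zero (hE.1 y)
    (le_antisymm ?_ (inner_nonneg_of_nonneg (hE.1 y) _))
  have := inner_nonneg_of_nonneg (sub_nonneg.mpr (hE.add_le_one hxy)) φ
  simpa [inner_sub_right, inner_add_right, h] using this

end Observables

/-! ### Positivity of completely positive maps -/

section CompletePositivity

variable {H K : Type*} [NormedAddCommGroup H] [InnerProductSpace ℂ H]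
  [NormedAddCommGroup K] [InnerProductSpace ℂ K]

theorem IsCompletelyPositive.map_nonneg [CompleteSpace H] [CompleteSpace K]
    {Φ : TraceClass H →ₗ[ℂ] TraceClass K} (hΦ : IsCompletelyPositive Φ) {T : TraceClass H}
    (hT : 0 ≤ (T : H →L[ℂ] H)) : 0 ≤ (Φ T : K →L[ℂ] K) :=
  nonneg_of_inner_nonneg fun v => by
    simpa using hΦ 1 (fun _ _ => T) (fun w => by simpa using inner_nonneg_of_nonneg hT (w 0))
      fun _ => v

end CompletePositivity

/-! ### Polarising the conservation law -/

section Conservation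

variable {X H K : Type*} [NormedAddCommGroup H] [InnerProductSpace ℂ H] [CompleteSpace H]
  [FiniteDimensional ℂ H]
  [NormedAddCommGroup K] [InnerProductSpace ℂ K] [CompleteSpace K]

/-- The trace-class operator `|x⟩⟨y|`. -/
noncomputable def TraceClass.rankOne (x y : H) : TraceClass H :=
  ⟨InnerProductSpace.rankOne ℂ x y, IsTraceClass.rankOne x y⟩

omit [FiniteDimensional ℂ H] in
theorem TraceClass.isState_rankOne {φ : H} (hφ : ‖φ‖ = 1) : IsState (TraceClass.rankOne φ φ) := by
  refine ⟨(ContinuousLinearMap.nonneg_iff_isPositive _).mpr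
    (InnerProductSpace.isPositive_rankOne_self φ), ?_⟩
  simp [TraceClass.rankOne, tr_rankOne, hφ]

theorem TraceClass.isState_rankOne_tensor {φ : H} (hφ : ‖φ‖ = 1) {ξ : TraceClass K}
    (hξ : IsState ξ) : IsState (TraceClass.tensor (TraceClass.rankOne φ φ) ξ) := by
  refine ⟨mapL_nonneg (TraceClass.isState_rankOne hφ).1 hξ.1, ?_⟩
  simp [TraceClass.tensor, TraceClass.rankOne, tr_mapL_rankOne _ _ ξ.2, hξ.2, hφ]

variable (M : MeasurementScheme X H K)

/-- By polarisation, conservation on average extends to the operators `|x⟩⟨y| ⊗ ξ`. -/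
theorem MeasurementScheme.tr_interaction_rankOne {N : H ⊗[ℂ] K →L[ℂ] H ⊗[ℂ] K}
    (hN : ConservesOnAverage M.interaction N) (x y : H) :
    tr (N * (M.interaction (TraceClass.tensor (TraceClass.rankOne x y) M.apparatusState)).1) =
      tr (N * (TraceClass.tensor (TraceClass.rankOne x y) M.apparatusState).1) := by
  -- The conservation defect is linear, so `q` below is sesquilinear; it vanishes on the diagonal
  -- because normalised vectors give states.
  let D : TraceClass (H ⊗[ℂ] K) →ₗ[ℂ] ℂ :=
    { toFun := fun T => tr (N * (M.interaction T).1) - tr (N * T.1)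
      map_add' := fun S T => by
        simp only [map_add, Submodule.coe_add, mul_add]
        rw [tr_add ((M.interaction S).2.mul_left N) ((M.interaction T).2.mul_left N),
          tr_add (S.2.mul_left N) (T.2.mul_left N)]
        ring
      map_smul' := fun c T => by
        simp only [map_smul, Submodule.coe_smul, mul_smul_comm]
        rw [tr_smul c ((M.interaction T).2.mul_left N), tr_smul c (T.2.mul_left N)]
        simp [mul_sub] }
  let q (x y : H) : ℂ := D (TraceClass.tensor (TraceClass.rankOne x y) M.apparatusState)
  have hadd (x x' y : H) : q (x + x') y = q x y + q x' y := by
    simp only [q, ← map_add]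
    congr 1
    apply Subtype.ext
    simp [TraceClass.tensor, TraceClass.rankOne, TensorProduct.mapL_add_left]
  have hadd' (x y y' : H) : q x (y + y') = q x y + q x y' := by
    simp only [q, ← map_add]
    congr 1
    apply Subtype.ext
    simp [TraceClass.tensor, TraceClass.rankOne, TensorProduct.mapL_add_left]
  have hsmul (c : ℂ) (x y : H) : q (c • x) y = c * q x y := by
    simp only [q, ← smul_eq_mul, ← map_smul]
    congr 1
    apply Subtype.ext
    simp [TraceClass.tensor, TraceClass.rankOne, TensorProduct.mapL_smul_left]
  have hsmul' (c : ℂ) (x y : H) : q x (c • y) = (starRingEnd ℂ) c * q x y := by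
    simp only [q, ← smul_eq_mul, ← map_smul]
    congr 1
    apply Subtype.ext
    simp [TraceClass.tensor, TraceClass.rankOne, TensorProduct.mapL_smul_left]
  have hdiag (x : H) : q x x = 0 := by
    by_cases hx : x = 0
    · simpa [hx] using hsmul 0 x x
    have hn : (‖x‖ : ℂ) ≠ 0 := by simpa using hx
    have h1 : q ((‖x‖⁻¹ : ℂ) • x) ((‖x‖⁻¹ : ℂ) • x) = 0 :=
      sub_eq_zero.mpr (hN _ (TraceClass.isState_rankOne_tensor (by simp [norm_smul, hx]) M.isState))
    rw [hsmul, hsmul'] at h1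
    simpa [hx] using h1
  refine sub_eq_zero.mp (?_ : q x y = 0)
  -- These two diagonal values give the sum and the difference of `q x y` and `q y x`.
  have h1 := hdiag (x + y)
  have h2 := hdiag (x + Complex.I • y)
  simp only [hadd, hadd', hsmul, hsmul', hdiag, Complex.conj_I] at h1 h2
  have h3 : Complex.I * (q x y - q y x) = 0 := by linear_combination -h2
  have h4 : q x y - q y x = 0 := by simpa using h3
  linear_combination h1 / 2 + h4 / 2

end Conservation

/-! ### Certainty after the interaction, and loss of coherence -/

section WignerArakiYanase

variable {X H K : Type*} [NormedAddCommGroup H] [InnerProductSpace ℂ H] [CompleteSpace H]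
  [FiniteDimensional ℂ H]
  [NormedAddCommGroup K] [InnerProductSpace ℂ K] [CompleteSpace K]
  {E : X → (H →L[ℂ] H)} {I : X → (TraceClass H →ₗ[ℂ] TraceClass H)}
  {M : MeasurementScheme X H K}

/-- The pointer indicates an outcome with certainty if the observable does. -/
theorem tr_pointer_mul_interaction (hI : IsInstrumentFor E I) (hM : M.Implements I) {x : X}
    {φ : H} (hφ : ‖φ‖ = 1) (h : E x φ = φ) :
    tr (TensorProduct.mapL 1 (M.pointer x) *
      (M.interaction (TraceClass.tensor (TraceClass.rankOne φ φ) M.apparatusState)).1) =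
    tr (M.interaction (TraceClass.tensor (TraceClass.rankOne φ φ) M.apparatusState)).1 := by
  -- Testing the partial trace against `1` gives the outcome probability.
  have h1 := hM x (TraceClass.rankOne φ φ) 1
  rw [mapL_one_one, one_mul, one_mul, hI.2] at h1
  rw [← h1, M.isChannel.2, (TraceClass.isState_rankOne_tensor hφ M.isState).2]
  simp [TraceClass.rankOne, ContinuousLinearMap.mul_def, InnerProductSpace.comp_rankOne,
    tr_rankOne, h, hφ]

/-- After a repeatable measurement, the observable has the obtained outcome with certainty. -/
theorem tr_observable_mul_interaction (hI : IsInstrumentFor E I) (hM : M.Implements I)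
    (hrep : IsRepeatable I) {x : X}
    {φ : H} (hφ : ‖φ‖ = 1) (h : E x φ = φ) :
    tr (TensorProduct.mapL (E x) 1 *
      (M.interaction (TraceClass.tensor (TraceClass.rankOne φ φ) M.apparatusState)).1) =
    tr (M.interaction (TraceClass.tensor (TraceClass.rankOne φ φ) M.apparatusState)).1 := by
  set S := M.interaction (TraceClass.tensor (TraceClass.rankOne φ φ) M.apparatusState) with hS
  have hZ := tr_pointer_mul_interaction hI hM hφ h
  rw [← hS] at hZ
  have hρ := TraceClass.isState_rankOne hφ
  have hle : 0 ≤ 1 - TensorProduct.mapL (1 : H →L[ℂ] H) (M.pointer x) := by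
    have h1 : M.pointer x ≤ 1 := sub_nonneg.mp <| nonneg_of_inner_nonneg fun ψ => by
      have := sum_le_hasSum {x} (fun z _ => inner_nonneg_of_nonneg (M.isObservable.1 z) ψ)
        ((M.isObservable.2 ψ).mapL (innerSL ℂ ψ))
      simpa [inner_sub_right] using this
    simpa using mapL_right_add_le_one (H := H) (F := M.pointer x) (G := 0) (by simpa using h1)
  -- Since the pointer value is certain, `S = S (1 ⊗ Z(x))`. Conditioning on `x` is then harmless,
  -- and repeatability, which speaks of `I x`, applies to `S` itself.
  have h0 : S.1 * (1 - TensorProduct.mapL (1 : H →L[ℂ] H) (M.pointer x)) = 0 := by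
    refine mul_eq_zero_of_tr_mul_eq_zero hle
      (M.isChannel.1.map_nonneg (TraceClass.isState_rankOne_tensor hφ M.isState).1) S.2 ?_
    rw [sub_mul, one_mul, tr_sub S.2 (S.2.mul_left _), hZ, sub_self]
  rw [mul_sub, mul_one, sub_eq_zero] at h0
  have h1 := hM x (TraceClass.rankOne φ φ) (E x)
  rw [← hI.2, hrep _ hρ, if_pos rfl, ← hS] at h1
  have h2 := hM x (TraceClass.rankOne φ φ) 1
  rw [one_mul, mapL_one_one, one_mul, ← hS, hZ] at h2
  rw [← h2, h1]
  nth_rw 1 [h0]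
  rw [← mul_assoc, ← tr_mul_comm _ (S.2.mul_left _), ← mul_assoc, ← mul_assoc,
    (commute_mapL _ _).eq]

/-- A repeatable measurement obeying an additive conservation law leaves no coherence of the
conserved quantity between states that yield different outcomes with certainty. -/
theorem inner_eq_zero_of_repeatable (hE : IsObservable E) (hI : IsInstrumentFor E I)
    (hM : M.Implements I) {NS : H →L[ℂ] H} {NA : K →L[ℂ] K}
    (hcons : ConservesOnAverage M.interaction (additive NS NA)) (hrep : IsRepeatable I)
    {x y : X} (hxy : x ≠ y) {φ ψ : H} (hφ : E x φ = φ) (hψ : E y ψ = ψ) :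
    ⟪ψ, NS φ⟫_ℂ = 0 := by
  wlog hφ1 : ‖φ‖ = 1 generalizing φ
  · by_cases h0 : φ = 0
    · simp [h0]
    have := this (φ := (‖φ‖⁻¹ : ℂ) • φ) (by rw [map_smul, hφ]) (by simp [norm_smul, h0])
    simpa [inner_smul_right, h0] using this
  wlog hψ1 : ‖ψ‖ = 1 generalizing ψ
  · by_cases h0 : ψ = 0
    · simp [h0]
    have := this (ψ := (‖ψ‖⁻¹ : ℂ) • ψ) (by rw [map_smul, hψ]) (by simp [norm_smul, h0])
    simpa [inner_smul_left, h0] using this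
  -- `φ` and `ψ` are eigenvectors of `E x` for the eigenvalues `1` and `0`.
  have horth : ⟪ψ, φ⟫_ℂ = 0 := by
    have h1 : ⟪ψ, E x φ⟫_ℂ = ⟪E x ψ, φ⟫_ℂ :=
      ((IsSelfAdjoint.of_nonneg (hE.1 x)).isSymmetric ψ φ).symm
    rwa [hφ, hE.apply_eq_zero hxy.symm hψ, inner_zero_left] at h1
  let v : Fin 2 → H := ![φ, ψ]
  let S (i j : Fin 2) : H ⊗[ℂ] K →L[ℂ] H ⊗[ℂ] K :=
    (M.interaction (TraceClass.tensor (TraceClass.rankOne (v i) (v j)) M.apparatusState)).1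
  have hS (i j) : IsTraceClass (S i j) := Subtype.property _
  have hpos : BlockPositive S := M.isChannel.1 2 _ (blockPositive_rankOne_tensor v M.isState.1)
  have hA : tr (TensorProduct.mapL NS 1 * S 0 1) = 0 :=
    hpos.tr_mul_eq_zero hS (mapL_nonneg zero_le_one (M.isObservable.1 x))
      (mapL_nonneg zero_le_one (M.isObservable.1 y))
      (mapL_right_add_le_one (M.isObservable.add_le_one hxy))
      (tr_pointer_mul_interaction hI hM hφ1 hφ) (tr_pointer_mul_interaction hI hM hψ1 hψ)
      (commute_mapL _ _)
  -- The pointer effects need not commute with `1 ⊗ NA`, so `E ⊗ 1` replaces them; this is where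
  -- repeatability enters.
  have hB : tr (TensorProduct.mapL 1 NA * S 0 1) = 0 :=
    hpos.tr_mul_eq_zero hS (mapL_nonneg (hE.1 x) zero_le_one) (mapL_nonneg (hE.1 y) zero_le_one)
      (mapL_left_add_le_one (hE.add_le_one hxy))
      (tr_observable_mul_interaction hI hM hrep hφ1 hφ)
      (tr_observable_mul_interaction hI hM hrep hψ1 hψ)
      (commute_mapL _ _).symm
  have hc : tr (additive NS NA * S 0 1) = _ := M.tr_interaction_rankOne hcons φ ψ
  rw [additive, add_mul, tr_add ((hS 0 1).mul_left _) ((hS 0 1).mul_left _), hA, hB, add_zero,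
    add_mul] at hc
  have hξ := M.apparatusState.2
  have e1 : TensorProduct.mapL NS 1 *
      (TraceClass.tensor (TraceClass.rankOne φ ψ) M.apparatusState).1 =
      TensorProduct.mapL (InnerProductSpace.rankOne ℂ (NS φ) ψ) M.apparatusState.1 := by
    simp only [TraceClass.tensor, TraceClass.rankOne, ← TensorProduct.mapL_mul, one_mul]
    rw [ContinuousLinearMap.mul_def, InnerProductSpace.comp_rankOne]
  have e2 : TensorProduct.mapL 1 NA *
      (TraceClass.tensor (TraceClass.rankOne φ ψ) M.apparatusState).1 =
      TensorProduct.mapL (InnerProductSpace.rankOne ℂ φ ψ) (NA * M.apparatusState.1) := by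
    simp only [TraceClass.tensor, TraceClass.rankOne, ← TensorProduct.mapL_mul, one_mul]
  rw [e1, e2, tr_add ((IsTraceClass.rankOne _ _).tensor hξ)
    ((IsTraceClass.rankOne _ _).tensor (hξ.mul_left NA)), tr_mapL_rankOne _ _ hξ,
    tr_mapL_rankOne _ _ (hξ.mul_left NA), horth, M.isState.2] at hc
  simpa using hc.symm

end WignerArakiYanase

/-! ### Certainty projections and compression -/

section CertaintyProjection

variable {X H : Type*} [NormedAddCommGroup H] [InnerProductSpace ℂ H] [FiniteDimensional ℂ H]
  {E : X → (H →L[ℂ] H)}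

theorem observable_apply_certaintyProjection (x : X) (v : H) :
    E x (certaintyProjection E x v) = certaintyProjection E x v := by
  have := Module.End.mem_eigenspace_iff.mp
    (Submodule.starProjection_apply_mem (Module.End.eigenspace (E x : H →ₗ[ℂ] H) 1) v)
  rwa [one_smul] at this

theorem certaintyProjection_apply_eq_self {x : X} {v : H} (h : E x v = v) :
    certaintyProjection E x v = v :=
  Submodule.starProjection_eq_self_iff.mpr (by simpa [Module.End.mem_eigenspace_iff] using h)

variable [CompleteSpace H]

theorem certaintyProjection_isSelfAdjoint (x : X) : IsSelfAdjoint (certaintyProjection E x) :=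
  isSelfAdjoint_starProjection _

theorem IsObservable.mul_certaintyProjection (hE : IsObservable E) {x y : X} (hxy : x ≠ y) :
    E x * certaintyProjection E y = 0 := by
  ext v
  exact hE.apply_eq_zero hxy.symm (observable_apply_certaintyProjection y v)

/-- Eigenspaces of distinct outcomes are orthogonal, and a finite-dimensional space holds only
finitely many nonzero ones. -/
theorem IsObservable.finite_certaintyProjection_ne_zero (hE : IsObservable E) :
    {x | certaintyProjection E x ≠ 0}.Finite := by
  have hort : OrthogonalFamily ℂ
      (fun x => Module.End.eigenspace (E x : H →ₗ[ℂ] H) 1)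
      fun x => (Module.End.eigenspace (E x : H →ₗ[ℂ] H) 1).subtypeₗᵢ := by
    intro x y hxy v w
    have hv : E x v = v := by simpa using Module.End.mem_eigenspace_iff.mp v.2
    have hw : E y w = w := by simpa using Module.End.mem_eigenspace_iff.mp w.2
    have h1 : ⟪E x v, (w : H)⟫_ℂ = ⟪(v : H), E x w⟫_ℂ :=
      (IsSelfAdjoint.of_nonneg (hE.1 x)).isSymmetric v w
    rw [hv, hE.apply_eq_zero hxy.symm hw, inner_zero_right] at h1
    exact h1
  refine (WellFoundedGT.finite_ne_bot_of_iSupIndep hort.independent).subset fun x hx h => hx ?_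
  simp [certaintyProjection, h]

theorem IsObservable.summable_certaintyProjection (hE : IsObservable E) :
    Summable (certaintyProjection E) :=
  summable_of_hasFiniteSupport hE.finite_certaintyProjection_ne_zero

theorem IsObservable.mul_totalCertaintyProjection (hE : IsObservable E) (x : X) :
    E x * totalCertaintyProjection E = certaintyProjection E x := by
  rw [totalCertaintyProjection, ← hE.summable_certaintyProjection.tsum_mul_left,
    tsum_eq_single x fun y hy => hE.mul_certaintyProjection hy.symm]
  ext v
  exact observable_apply_certaintyProjection x v

theorem totalCertaintyProjection_isSelfAdjoint : IsSelfAdjoint (totalCertaintyProjection E) := by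
  rw [IsSelfAdjoint, totalCertaintyProjection, tsum_star]
  exact tsum_congr fun x => certaintyProjection_isSelfAdjoint x

theorem IsObservable.totalCertaintyProjection_mul (hE : IsObservable E) (x : X) :
    totalCertaintyProjection E * E x = certaintyProjection E x := by
  have := congr(star $(hE.mul_totalCertaintyProjection x))
  rwa [star_mul, (IsSelfAdjoint.of_nonneg (hE.1 x)).star_eq,
    totalCertaintyProjection_isSelfAdjoint.star_eq,
    (certaintyProjection_isSelfAdjoint x).star_eq] at this

/-- If `N` has no matrix elements between distinct certainty subspaces, its compression to their
sum commutes with the observable. -/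
theorem IsObservable.commute_compression (hE : IsObservable E) {N : H →L[ℂ] H}
    (hN : ∀ x y, x ≠ y → certaintyProjection E y * N * certaintyProjection E x = 0) (x : X) :
    Commute (E x) (totalCertaintyProjection E * N * totalCertaintyProjection E) := by
  have hs := hE.summable_certaintyProjection
  -- Both products collapse to `P(x) N P(x)`, the cross terms being zero by `hN`.
  have h1 : E x * (totalCertaintyProjection E * N * totalCertaintyProjection E) =
      certaintyProjection E x * N * certaintyProjection E x := by
    rw [← mul_assoc, ← mul_assoc, hE.mul_totalCertaintyProjection, totalCertaintyProjection,
      ← hs.tsum_mul_left, tsum_eq_single x fun y hy => hN y x hy]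
  have h2 : totalCertaintyProjection E * N * totalCertaintyProjection E * E x =
      certaintyProjection E x * N * certaintyProjection E x := by
    rw [mul_assoc, hE.totalCertaintyProjection_mul, mul_assoc, totalCertaintyProjection,
      ← hs.tsum_mul_right, tsum_eq_single x fun y hy => by rw [← mul_assoc, hN x y hy.symm],
      ← mul_assoc]
  exact h1.trans h2.symm

theorem IsObservable.certaintyProjection_eq_of_isSharp (hE : IsObservable E) (h : IsSharp E)
    (x : X) : certaintyProjection E x = E x := by
  have h1 : E x * certaintyProjection E x = certaintyProjection E x := by
    ext v
    exact observable_apply_certaintyProjection x v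
  -- Idempotence of `E x` places its range in the eigenspace; the adjoint of `h1` evaluates the same
  -- product as `P(x)`.
  have h2 : certaintyProjection E x * E x = E x := by
    ext v
    exact certaintyProjection_apply_eq_self congr($((h x x).trans (if_pos rfl)) v)
  have h3 := congr(star $h1)
  rw [star_mul, (IsSelfAdjoint.of_nonneg (hE.1 x)).star_eq,
    (certaintyProjection_isSelfAdjoint x).star_eq] at h3
  exact h3.symm.trans h2

theorem IsObservable.totalCertaintyProjection_eq_one (hE : IsObservable E) (h : IsSharp E) :
    totalCertaintyProjection E = 1 := by
  ext v
  have h1 := hE.summable_certaintyProjection.hasSum.mapL (ContinuousLinearMap.apply ℂ H v)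
  refine h1.unique ?_
  simpa [hE.certaintyProjection_eq_of_isSharp h] using hE.2 v

end CertaintyProjection

end QMeas

/-! ### The corollary -/

open QMeas
theorem mainTheorem12 {X HS HA : Type*} [Countable X]
    [NormedAddCommGroup HS] [InnerProductSpace ℂ HS] [CompleteSpace HS] [FiniteDimensional ℂ HS]
    [NormedAddCommGroup HA] [InnerProductSpace ℂ HA] [CompleteSpace HA]
    (E : X → (HS →L[ℂ] HS)) (hE : IsObservable E)
    (I : X → (TraceClass HS →ₗ[ℂ] TraceClass HS)) (hI : IsInstrumentFor E I)
    (M : MeasurementScheme X HS HA) (hM : M.Implements I)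
    (NS : HS →L[ℂ] HS) (hNS : IsSelfAdjoint NS) (NA : HA →L[ℂ] HA) (hNA : IsSelfAdjoint NA)
    (hcons : ConservesOnAverage M.interaction (additive NS NA))
    (hrep : IsRepeatable I) :
    Summable (certaintyProjection E) ∧
    (∀ x, Commute (E x) (totalCertaintyProjection E * NS * totalCertaintyProjection E)) ∧
    (IsSharp E → totalCertaintyProjection E = 1 ∧ ∀ x, Commute (E x) NS) := by
  have hcomm := hE.commute_compression (N := NS) fun x y hxy => by
    ext v
    refine ext_inner_left ℂ fun w => ?_
    have h := inner_eq_zero_of_repeatable hE hI hM hcons hrep hxy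
      (observable_apply_certaintyProjection x v) (observable_apply_certaintyProjection y w)
    have h2 : ⟪certaintyProjection E y w, NS (certaintyProjection E x v)⟫_ℂ =
        ⟪w, certaintyProjection E y (NS (certaintyProjection E x v))⟫_ℂ :=
      (certaintyProjection_isSelfAdjoint y).isSymmetric w _
    rw [h2] at h
    simpa using h
  refine ⟨hE.summable_certaintyProjection, hcomm, fun hsharp => ?_⟩
  have h1 := hE.totalCertaintyProjection_eq_one hsharp
  exact ⟨h1, fun x => by simpa [h1] using hcomm x⟩
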